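/- Conventions. All Hilbert spaces are nonzero and finite-dimensional and all sets $\mathcal U$ are finite. $\mathsf L(\mathcal H)$ denotes the linear operators on $\mathcal H$. A quantum channel is a completely positive trace-preserving linear map; a state is a positive semidefinite operator of unit trace; a state on $\mathcal H_1\otimes\mathcal H_2$ is separable if it is a finite convex combination of products $\sigma\otimes\tau$ of states. A POVM $\{P^u\}_{u\in\mathcal U}$ on $\mathcal H$ is a family of positive semidefinite operators with $\sum_u P^u=I$. An ensemble $\{p(u);\omega^u\}_{u\in\mathcal U}$ consists of a probability distribution $p$ on $\mathcal U$ and states $\omega^u$, and its guessing probability is $$P_{\rm guess}\{p(u);\omega^u\}=\max_{P}\sum_{u\in\mathcal U}p(u)\,\mathrm{Tr}[\omega^uP^u],$$ the maximum being over all POVMs $P=\{P^u\}_{u\in\mathcal U}$. For channels $\Phi,\Phi'$ with the same input space, $\Phi\succeq_{\mathcal U}\Phi'$ means that $P_{\rm guess}\{p(u);\Phi(\omega^u)\}\ge P_{\rm guess}\{p(u);\Phi'(\omega^u)\}$ for every ensemble $\{p(u);\omega^u\}_{u\in\mathcal U}$ of states on the input space. A channel is complete if it is bijective as a linear map, and measure-and-prepare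 if it has the form $X\mapsto\sum_i\mathrm{Tr}[XP^i]\,\sigma^i$ for a finite POVM $\{P^i\}$ and states $\sigma^i$. **Theorem (fully quantum reverse data-processing theorem).** Let $\Phi:\mathsf L(\mathcal H_A)\to\mathsf L(\mathcal H_B)$ and $\Phi':\mathsf L(\mathcal H_A)\to\mathsf L(\mathcal H_{B'})$ be quantum channels and let $\mathcal H_{B''}\cong\mathcal H_{B'}$. 1. The following are equivalent: (i) $\mathrm{id}_{B''}\otimes\Phi\succeq_{\mathcal U}\mathrm{id}_{B''}\otimes\Phi'$ for every set $\mathcal U$; (ii) $\mathrm{id}_{B''}\otimes\Phi\succeq_{\mathcal U}\mathrm{id}_{B''}\otimes\Phi'$ for some set $\mathcal U$ with $|\mathcal U|=(\dim\mathcal H_{B'})^2$; (iii) there is a quantum channel $\Psi:\mathsf L(\mathcal H_B)\to\mathsf L(\mathcal H_{B'})$ with $\Phi'=\Psi\circ\Phi$. 2. For every complete channel $\Upsilon:\mathsf L(\mathcal H_{B''})\to\mathsf L(\mathcal H_{B''})$, the equivalence in 1 also holds with $\mathrm{id}_{B''}$ replaced by $\Upsilon$ in (i) and (ii). 3. There is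 a complete channel $\Upsilon:\mathsf L(\mathcal H_{B''})\to\mathsf L(\mathcal H_{B''})$ that is measure-and-prepare. 4. The equivalence in 1 also holds if in (i) and (ii) the guessing probabilities at the outputs of $\mathrm{id}_{B''}\otimes\Phi$ and $\mathrm{id}_{B''}\otimes\Phi'$ are compared only for ensembles $\{p(u);\omega^u\}_{u\in\mathcal U}$ in which every $\omega^u$ is a separable state on $\mathcal H_{B''}\otimes\mathcal H_A$. -/

import Mathlib

/-!
Finite-dimensional quantum systems in orthonormal coordinates: a system with Hilbert space
`ℂ^A` (for a finite index type `A`) has operator algebra `Matrix A A ℂ`; the composite of two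
systems `A` and `B` has index type `A × B`, and `X ⊗ Y` is the Kronecker product.
-/

open scoped ComplexOrder Kronecker

universe u

namespace Quantum

noncomputable section

/-- The algebra `L(ℂ^A)` of linear operators on the Hilbert space `ℂ^A`. -/
abbrev Op (A : Type*) : Type _ := Matrix A A ℂ

/-- The tensor product `Φ₁ ⊗ Φ₂ : L(A₁ ⊗ A₂) → L(B₁ ⊗ B₂)` of two linear maps between operator
algebras, under the identification of `L(A₁) ⊗ L(A₂)` with `L(A₁ ⊗ A₂)`. -/
def tensorMap {A₁ B₁ A₂ B₂ : Type*}
    [Fintype A₁] [DecidableEq A₁] [Fintype B₁] [DecidableEq B₁]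
    [Fintype A₂] [DecidableEq A₂] [Fintype B₂] [DecidableEq B₂]
    (Φ₁ : Op A₁ →ₗ[ℂ] Op B₁) (Φ₂ : Op A₂ →ₗ[ℂ] Op B₂) :
    Op (A₁ × A₂) →ₗ[ℂ] Op (B₁ × B₂) :=
  (kroneckerLinearEquiv B₁ B₁ B₂ B₂ ℂ).toLinearMap ∘ₗ
    TensorProduct.map Φ₁ Φ₂ ∘ₗ (kroneckerLinearEquiv A₁ A₁ A₂ A₂ ℂ).symm.toLinearMap

theorem tensorMap_kronecker {A₁ B₁ A₂ B₂ : Type*}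
    [Fintype A₁] [DecidableEq A₁] [Fintype B₁] [DecidableEq B₁]
    [Fintype A₂] [DecidableEq A₂] [Fintype B₂] [DecidableEq B₂]
    (Φ₁ : Op A₁ →ₗ[ℂ] Op B₁) (Φ₂ : Op A₂ →ₗ[ℂ] Op B₂) (X : Op A₁) (Y : Op A₂) :
    tensorMap Φ₁ Φ₂ (X ⊗ₖ Y) = Φ₁ X ⊗ₖ Φ₂ Y := by
  simp [tensorMap]

/-- A quantum channel: a completely positive, trace-preserving linear map. Complete positivity
means that `id_k ⊗ Φ` maps positive semidefinite operators to positive semidefinite operators for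
every auxiliary dimension `k`. -/
structure IsChannel {A B : Type*} [Fintype A] [DecidableEq A] [Fintype B] [DecidableEq B]
    (Φ : Op A →ₗ[ℂ] Op B) : Prop where
  completelyPositive : ∀ (k : ℕ) (X : Op (Fin k × A)), X.PosSemidef →
    (tensorMap (LinearMap.id : Op (Fin k) →ₗ[ℂ] Op (Fin k)) Φ X).PosSemidef
  tracePreserving : ∀ X : Op A, (Φ X).trace = X.trace

/-- A complete channel: one that is bijective as a linear map. -/
structure IsCompleteChannel {A B : Type*} [Fintype A] [DecidableEq A] [Fintype B] [DecidableEq B]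
    (Υ : Op A →ₗ[ℂ] Op B) : Prop extends IsChannel Υ where
  bijective : Function.Bijective Υ

/-- States (density operators): positive semidefinite operators of unit trace. -/
structure IsState {A : Type*} [Fintype A] (ρ : Op A) : Prop where
  posSemidef : ρ.PosSemidef
  trace_eq_one : ρ.trace = 1

/-- A separable state: a finite convex combination of products of states. -/
def IsSeparable {A B : Type*} [Fintype A] [Fintype B] (ρ : Op (A × B)) : Prop :=
  ∃ (n : ℕ) (q : Fin n → ℝ) (σ : Fin n → Op A) (τ : Fin n → Op B),
    (∀ i, 0 ≤ q i) ∧ ∑ i, q i = 1 ∧ (∀ i, IsState (σ i)) ∧ (∀ i, IsState (τ i)) ∧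
      ρ = ∑ i, (q i : ℂ) • (σ i ⊗ₖ τ i)

/-- A POVM with outcomes in the finite set `U`. -/
structure IsPOVM {U A : Type*} [Fintype U] [DecidableEq A] (P : U → Op A) : Prop where
  posSemidef : ∀ x, (P x).PosSemidef
  sum_eq_one : ∑ x, P x = 1

/-- A measure-and-prepare map: measure a POVM, then prepare a state depending on the outcome. -/
def IsMeasureAndPrepare {A B : Type*} [Fintype A] [DecidableEq A] [Fintype B]
    (Υ : Op A →ₗ[ℂ] Op B) : Prop :=
  ∃ (n : ℕ) (P : Fin n → Op A) (σ : Fin n → Op B),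
    IsPOVM P ∧ (∀ i, IsState (σ i)) ∧ ∀ X, Υ X = ∑ i, (X * P i).trace • σ i

/-- An ensemble `{p(u); ω^u}` of states, indexed by the finite set `U`. -/
structure Ensemble (U A : Type*) [Fintype U] [Fintype A] where
  p : U → ℝ
  ω : U → Op A
  p_nonneg : ∀ x, 0 ≤ p x
  p_sum : ∑ x, p x = 1
  isState : ∀ x, IsState (ω x)

/-- The guessing probability `max_P ∑_u p(u) Tr[ρ^u P^u]`, over all POVMs `P` with outcomes in
`U`. (For an ensemble of states the set below is nonempty and compact.) -/
def guessProb {U A : Type*} [Fintype U] [Fintype A] [DecidableEq A]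
    (p : U → ℝ) (ρ : U → Op A) : ℝ :=
  sSup {r : ℝ | ∃ P : U → Op A, IsPOVM P ∧ r = ∑ x, p x * ((ρ x * P x).trace).re}

/-- `Φ ⪰_U Φ'` (`Φ` is `U`-sufficient for `Φ'`): for every ensemble indexed by `U`, the guessing
probability at the output of `Φ` is at least that at the output of `Φ'`. -/
def Sufficient (U : Type*) [Fintype U] {A B B' : Type*}
    [Fintype A] [Fintype B] [DecidableEq B] [Fintype B'] [DecidableEq B']
    (Φ : Op A →ₗ[ℂ] Op B) (Φ' : Op A →ₗ[ℂ] Op B') : Prop :=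
  ∀ E : Ensemble U A,
    guessProb E.p (fun x => Φ (E.ω x)) ≥ guessProb E.p (fun x => Φ' (E.ω x))

/-- The relation `Φ ⪰_U Φ'` for channels with a bipartite input, probed only by ensembles of
separable states. -/
def SepSufficient (U : Type*) [Fintype U] {R A B B' : Type*} [Fintype R]
    [Fintype A] [Fintype B] [DecidableEq B] [Fintype B'] [DecidableEq B']
    (Φ : Op (R × A) →ₗ[ℂ] Op B) (Φ' : Op (R × A) →ₗ[ℂ] Op B') : Prop :=
  ∀ E : Ensemble U (R × A), (∀ x, IsSeparable (E.ω x)) →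
    guessProb E.p (fun x => Φ (E.ω x)) ≥ guessProb E.p (fun x => Φ' (E.ω x))

end

end Quantum

/-!
The reverse data-processing theorem: a channel `Φ'` factors through `Φ` if and only if `Φ` is at
least as good for guessing, in the presence of an auxiliary system of the size of the output
of `Φ'`.

If `Φ' = Ψ ∘ₗ Φ`, a POVM after `Υ ⊗ Φ'` is pulled back through the Heisenberg dual of `id ⊗ Ψ` to
a POVM with the same score after `Υ ⊗ Φ` (`Sufficient.of_comp`). Positivity of the pull-back is read
off a Kraus decomposition, which comes from Choi's theorem (`IsChannel.exists_krausMap`).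

Conversely, comparing guessing probabilities for all ensembles indexed by `U` amounts to comparing
the support functions of two sets of POVMs in the Heisenberg picture. As the set of POVMs is compact
and convex, the Hahn–Banach theorem shows that every POVM after `Υ ⊗ Φ'` acts on inputs like some
POVM after `Υ ⊗ Φ` (`Sufficient.exists_isPOVM`). A separating functional is turned into an ensemble
by adding one multiple of the identity to all its components and rescaling; trace preservation makes
this change both scores by the same affine function. This is applied to the Bell measurement of
`d ^ 2` outcomes. Surjectivity of `Υ` allows it to be cancelled, which leaves a joint measurement
`Q` of the auxiliary system and the output of `Φ` that imitates the Bell measurement performed after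
`Φ'`. Teleportation with the Bell measurement is the identity, so teleportation with `Q` in its
place is a channel `Ψ` satisfying `Φ' = Ψ ∘ₗ Φ` (`Sufficient.exists_isChannel_comp`).

For separable ensembles, the point is that a bijective channel `Υ` may be entanglement breaking:
measuring and re-preparing a spanning family of states whose sum is a multiple of the identity
(`exists_isCompleteChannel_isMeasureAndPrepare`). An arbitrary ensemble probing `Υ ⊗ Φ` is then a
separable one probing `id ⊗ Φ` (`SepSufficient.sufficient`), which reduces the claim to the
equivalence for `Υ`.
-/

namespace Quantum

open Matrix

set_option linter.unusedSectionVars false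

/-! ### Kraus decompositions of channels -/

/-- The completely positive map `X ↦ ∑ m, K m * X * (K m)ᴴ` with Kraus operators `K m`. -/
def krausMap {ι A B : Type*} [Fintype ι] [Fintype A] (K : ι → Matrix B A ℂ) :
    Op A →ₗ[ℂ] Op B where
  toFun X := ∑ m, K m * X * (K m)ᴴ
  map_add' X Y := by simp [Matrix.mul_add, Matrix.add_mul, Finset.sum_add_distrib]
  map_smul' c X := by simp [Finset.smul_sum]

theorem krausMap_apply {ι A B : Type*} [Fintype ι] [Fintype A] (K : ι → Matrix B A ℂ)
    (X : Op A) : krausMap K X = ∑ m, K m * X * (K m)ᴴ := rfl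

section

variable {A B A₁ B₁ A₂ B₂ C : Type*}
  [Fintype A] [DecidableEq A] [Fintype B] [DecidableEq B]
  [Fintype A₁] [DecidableEq A₁] [Fintype B₁] [DecidableEq B₁]
  [Fintype A₂] [DecidableEq A₂] [Fintype B₂] [DecidableEq B₂]
  [Fintype C] [DecidableEq C]

theorem linearMap_ext_kronecker {M : Type*} [AddCommMonoid M] [Module ℂ M]
    {f g : Op (A₁ × A₂) →ₗ[ℂ] M} (h : ∀ X Y, f (X ⊗ₖ Y) = g (X ⊗ₖ Y)) : f = g := by
  have : f ∘ₗ (kroneckerLinearEquiv A₁ A₁ A₂ A₂ ℂ).toLinearMap =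
      g ∘ₗ (kroneckerLinearEquiv A₁ A₁ A₂ A₂ ℂ).toLinearMap := by
    apply TensorProduct.ext'
    intro X Y
    simpa using h X Y
  ext1 Z
  simpa using LinearMap.congr_fun this ((kroneckerLinearEquiv A₁ A₁ A₂ A₂ ℂ).symm Z)

theorem tensorMap_comp (Φ₁ : Op A₁ →ₗ[ℂ] Op B₁) (Φ₂ : Op A →ₗ[ℂ] Op B)
    (Ψ₁ : Op B₁ →ₗ[ℂ] Op B₂) (Ψ₂ : Op B →ₗ[ℂ] Op C) :
    tensorMap (Ψ₁ ∘ₗ Φ₁) (Ψ₂ ∘ₗ Φ₂) = tensorMap Ψ₁ Ψ₂ ∘ₗ tensorMap Φ₁ Φ₂ :=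
  linearMap_ext_kronecker fun X Y => by simp [tensorMap_kronecker]

theorem tensorMap_krausMap {ι κ : Type*} [Fintype ι] [Fintype κ]
    (K : ι → Matrix B₁ A₁ ℂ) (M : κ → Matrix B₂ A₂ ℂ) :
    tensorMap (krausMap K) (krausMap M) = krausMap fun m : ι × κ => K m.1 ⊗ₖ M m.2 :=
  linearMap_ext_kronecker fun X Y => by
    ext ⟨i, k⟩ ⟨j, l⟩
    simp [tensorMap_kronecker, krausMap_apply, conjTranspose_kronecker, ← mul_kronecker_mul,
      Matrix.sum_apply, Finset.sum_mul_sum, Fintype.sum_prod_type]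

theorem krausMap_one : krausMap (fun _ : Unit => (1 : Op A)) = LinearMap.id := by
  ext1 X
  simp [krausMap_apply]

theorem krausMap_posSemidef {ι : Type*} [Fintype ι] (K : ι → Matrix B A ℂ) {X : Op A}
    (hX : X.PosSemidef) : (krausMap K X).PosSemidef :=
  posSemidef_sum _ fun m _ => hX.mul_mul_conjTranspose_same (K m)

theorem krausMap_conjTranspose {ι : Type*} [Fintype ι] (K : ι → Matrix B A ℂ) (X : Op A) :
    krausMap K Xᴴ = (krausMap K X)ᴴ := by
  simp [krausMap_apply, conjTranspose_sum, Matrix.mul_assoc]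

/-- The Heisenberg-picture dual of a Kraus map has the adjoint Kraus operators. -/
theorem trace_krausMap_mul {ι : Type*} [Fintype ι] (K : ι → Matrix B A ℂ) (X : Op A) (Y : Op B) :
    (krausMap K X * Y).trace = (X * krausMap (fun m => (K m)ᴴ) Y).trace := by
  simp only [krausMap_apply, Finset.sum_mul, Finset.mul_sum, trace_sum]
  refine Finset.sum_congr rfl fun m _ => ?_
  rw [Matrix.mul_assoc (K m), Matrix.mul_assoc (K m), Matrix.trace_mul_comm,
    conjTranspose_conjTranspose]
  simp only [Matrix.mul_assoc]

theorem eq_of_forall_trace_mul_eq {M N : Op A} (h : ∀ X : Op A, (X * M).trace = (X * N).trace) :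
    M = N := by
  ext i j
  simpa [trace_single_mul] using h (single j i 1)

theorem isChannel_krausMap {ι : Type*} [Fintype ι] (K : ι → Matrix B A ℂ)
    (hK : ∀ X, (krausMap K X).trace = X.trace) : IsChannel (krausMap K) where
  completelyPositive k X hX := by
    rw [← krausMap_one, tensorMap_krausMap]
    exact krausMap_posSemidef _ hX
  tracePreserving := hK

theorem tensorMap_id_apply (Φ : Op A →ₗ[ℂ] Op B) (X : Op (C × A)) (a b : C) (i j : B) :
    tensorMap (LinearMap.id : Op C →ₗ[ℂ] Op C) Φ X (a, i) (b, j) =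
      Φ (of fun x y => X (a, x) (b, y)) i j := by
  let f : Op (C × A) →ₗ[ℂ] Op A :=
    { toFun := fun X => of fun x y => X (a, x) (b, y)
      map_add' := fun _ _ => rfl
      map_smul' := fun _ _ => rfl }
  have key : entryLinearMap ℂ ℂ (a, i) (b, j) ∘ₗ
      tensorMap (LinearMap.id : Op C →ₗ[ℂ] Op C) Φ = entryLinearMap ℂ ℂ i j ∘ₗ Φ ∘ₗ f :=
    linearMap_ext_kronecker fun Y Z => by
      have : f (Y ⊗ₖ Z) = Y a b • Z := by ext x y; rfl
      simp [tensorMap_kronecker, this]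
  exact LinearMap.congr_fun key X

theorem exists_conjTranspose_mul_self_eq {M : Op A} (hM : M.PosSemidef) :
    ∃ R : Op A, M = Rᴴ * R := by
  open scoped MatrixOrder Matrix.Norms.L2Operator in
  exact CStarAlgebra.nonneg_iff_eq_star_mul_self.1 hM.nonneg

theorem exists_posSemidef_add_smul_one {H : Op A} (hH : H.IsHermitian) :
    ∃ t : ℝ, 0 ≤ t ∧ (H + (t : ℂ) • (1 : Op A)).PosSemidef := by
  open scoped MatrixOrder Matrix.Norms.L2Operator in
  have h := IsSelfAdjoint.neg_algebraMap_norm_le_self (a := H) hH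
  rw [Matrix.le_iff, sub_neg_eq_add, Algebra.algebraMap_eq_smul_one] at h
  exact ⟨‖H‖, norm_nonneg _, by simpa using h⟩

/-- Choi's theorem: the Choi matrix is the image of an unnormalized maximally entangled state,
hence positive semidefinite, and the rows of a square root of it are Kraus operators. -/
theorem IsChannel.exists_krausMap {Φ : Op A →ₗ[ℂ] Op B} (hΦ : IsChannel Φ) :
    ∃ K : A × B → Matrix B A ℂ, Φ = krausMap K := by
  let e := Fintype.equivFin A
  let v : Fin (Fintype.card A) × A → ℂ := fun x => if e x.2 = x.1 then 1 else 0
  have h := (hΦ.completelyPositive _ _ (posSemidef_vecMulVec_self_star v)).submatrix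
    (fun x : A × B => (e x.1, x.2))
  obtain ⟨R, hR⟩ := exists_conjTranspose_mul_self_eq h
  have hC : ∀ a b i j, Φ (single a b 1) i j = (Rᴴ * R) (a, i) (b, j) := by
    intro a b i j
    rw [← hR, submatrix_apply, tensorMap_id_apply]
    refine congr_fun (congr_fun (congr_arg Φ ?_) i) j
    ext x y
    simp only [vecMulVec, v, of_apply, single_apply, Pi.star_apply, e.injective.eq_iff]
    split_ifs <;> simp_all
  refine ⟨fun m => of fun i a => star (R m (a, i)), ?_⟩
  refine Matrix.ext_linearMap ℂ fun a b => LinearMap.ext_ring ?_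
  ext i j
  simp [hC, krausMap_apply, Matrix.sum_apply, Matrix.mul_apply, single_apply, ite_and]

theorem IsChannel.tensorMap {Φ₁ : Op A₁ →ₗ[ℂ] Op B₁} {Φ₂ : Op A₂ →ₗ[ℂ] Op B₂}
    (h₁ : IsChannel Φ₁) (h₂ : IsChannel Φ₂) : IsChannel (tensorMap Φ₁ Φ₂) := by
  obtain ⟨K, hK⟩ := h₁.exists_krausMap
  obtain ⟨M, hM⟩ := h₂.exists_krausMap
  have htr : traceLinearMap (B₁ × B₂) ℂ ℂ ∘ₗ Quantum.tensorMap Φ₁ Φ₂ =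
      traceLinearMap (A₁ × A₂) ℂ ℂ := linearMap_ext_kronecker fun X Y => by
    simp [tensorMap_kronecker, trace_kronecker, h₁.tracePreserving, h₂.tracePreserving]
  have : Quantum.tensorMap Φ₁ Φ₂ =
      krausMap fun m : (A₁ × B₁) × (A₂ × B₂) => K m.1 ⊗ₖ M m.2 := by
    rw [← tensorMap_krausMap, ← hK, ← hM]
  rw [this]
  refine isChannel_krausMap _ fun X => ?_
  rw [← this]
  exact LinearMap.congr_fun htr X

theorem isChannel_id : IsChannel (LinearMap.id : Op A →ₗ[ℂ] Op A) := by
  rw [← krausMap_one]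
  exact isChannel_krausMap _ fun X => by rw [krausMap_one]; rfl

theorem isCompleteChannel_id : IsCompleteChannel (LinearMap.id : Op A →ₗ[ℂ] Op A) where
  toIsChannel := isChannel_id
  bijective := Function.bijective_id

theorem IsChannel.map_conjTranspose {Φ : Op A →ₗ[ℂ] Op B} (hΦ : IsChannel Φ) (X : Op A) :
    Φ Xᴴ = (Φ X)ᴴ := by
  obtain ⟨K, rfl⟩ := hΦ.exists_krausMap
  exact krausMap_conjTranspose K X

theorem IsChannel.map_isState {Φ : Op A →ₗ[ℂ] Op B} (hΦ : IsChannel Φ) {ρ : Op A}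
    (hρ : IsState ρ) : IsState (Φ ρ) := by
  refine ⟨?_, by rw [hΦ.tracePreserving, hρ.trace_eq_one]⟩
  obtain ⟨K, rfl⟩ := hΦ.exists_krausMap
  exact krausMap_posSemidef K hρ.posSemidef

/-- In the Heisenberg picture a channel pulls POVMs back to POVMs. -/
theorem IsChannel.exists_isPOVM_pullback {Φ : Op A →ₗ[ℂ] Op B} (hΦ : IsChannel Φ)
    {U : Type*} [Fintype U] {P : U → Op B} (hP : IsPOVM P) :
    ∃ Q : U → Op A, IsPOVM Q ∧ ∀ x X, (Φ X * P x).trace = (X * Q x).trace := by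
  obtain ⟨K, rfl⟩ := hΦ.exists_krausMap
  refine ⟨fun x => krausMap (fun m => (K m)ᴴ) (P x),
    ⟨fun x => krausMap_posSemidef _ (hP.posSemidef x), ?_⟩, fun x X => trace_krausMap_mul K X _⟩
  rw [← map_sum, hP.sum_eq_one]
  refine eq_of_forall_trace_mul_eq fun X => ?_
  rw [← trace_krausMap_mul, mul_one, mul_one, hΦ.tracePreserving]

end

/-! ### POVMs and guessing probabilities -/

section

variable {A B B' U : Type*}
  [Fintype A] [DecidableEq A] [Fintype B] [DecidableEq B] [Fintype B'] [DecidableEq B']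
  [Fintype U]

/-- The entries of a positive semidefinite matrix are controlled by its diagonal: this is the
arithmetic-geometric mean inequality for the entries of a square root. -/
theorem norm_apply_le_of_posSemidef {M : Op A} (hM : M.PosSemidef) (i j : A) :
    2 * ‖M i j‖ ≤ (M i i).re + (M j j).re := by
  obtain ⟨R, rfl⟩ := exists_conjTranspose_mul_self_eq hM
  have hd : ∀ i, ((Rᴴ * R) i i).re = ∑ m, ‖R m i‖ ^ 2 := fun i => by
    simp [Matrix.mul_apply, Complex.sq_norm, Complex.normSq_apply]
  rw [hd, hd, ← Finset.sum_add_distrib, Matrix.mul_apply]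
  calc 2 * ‖∑ m, Rᴴ i m * R m j‖ ≤ 2 * ∑ m, ‖Rᴴ i m * R m j‖ := by gcongr; exact norm_sum_le _ _
    _ = ∑ m, 2 * (‖R m i‖ * ‖R m j‖) := by simp [Finset.mul_sum]
    _ ≤ _ := Finset.sum_le_sum fun m _ => by nlinarith [sq_nonneg (‖R m i‖ - ‖R m j‖)]

theorem IsPOVM.re_apply_self_le_one {P : U → Op A} (hP : IsPOVM P) (x : U) (i : A) :
    (P x i i).re ≤ 1 := by
  have h : ∑ y, (P y i i).re = 1 := by
    simpa [Matrix.sum_apply] using congr_arg (fun M : Op A => (M i i).re) hP.sum_eq_one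
  rw [← h]
  exact Finset.single_le_sum (f := fun y => (P y i i).re)
    (fun y _ => (Complex.le_def.1 (hP.posSemidef y).diag_nonneg).1) (Finset.mem_univ x)

theorem isClosed_posSemidef : IsClosed {M : Op A | M.PosSemidef} := by
  simp only [posSemidef_iff_dotProduct_mulVec, Set.ofPred_and, Set.ofPred_forall, IsHermitian]
  refine IsClosed.inter (isClosed_eq (by fun_prop) (by fun_prop)) ?_
  refine isClosed_iInter fun v => isClosed_le (by fun_prop) (by fun_prop)

theorem isCompact_setOf_isPOVM : IsCompact {P : U → Op A | IsPOVM P} := by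
  have hc : IsClosed {P : U → Op A | IsPOVM P} := by
    have : {P : U → Op A | IsPOVM P} =
        (⋂ x, {P | (P x).PosSemidef}) ∩ {P | ∑ x, P x = 1} := by
      ext P
      simp only [Set.mem_inter_iff, Set.mem_iInter, Set.mem_ofPred_eq]
      exact ⟨fun h => ⟨h.1, h.2⟩, fun h => ⟨h.1, h.2⟩⟩
    rw [this]
    refine IsClosed.inter (isClosed_iInter fun x => ?_) ?_
    · have hx : Continuous fun P : U → Op A => P x := continuous_apply x
      exact isClosed_posSemidef.preimage hx
    · exact isClosed_eq (by fun_prop) (by fun_prop)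
  -- `Matrix` has no global metric, but its topology is that of the function space
  refine Metric.isCompact_of_isClosed_isBounded (α := U → A → A → ℂ) hc ?_
  refine (Metric.isBounded_closedBall (x := (0 : U → A → A → ℂ)) (r := 1)).subset fun P hP => ?_
  rw [mem_closedBall_zero_iff]
  refine (pi_norm_le_iff_of_nonneg zero_le_one).2 fun x =>
    (pi_norm_le_iff_of_nonneg zero_le_one).2 fun i =>
      (pi_norm_le_iff_of_nonneg zero_le_one).2 fun j => ?_
  have := norm_apply_le_of_posSemidef (hP.posSemidef x) i j
  linarith [hP.re_apply_self_le_one x i, hP.re_apply_self_le_one x j]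

theorem convex_setOf_isPOVM : Convex ℝ {P : U → Op A | IsPOVM P} := by
  intro P hP Q hQ a b ha hb hab
  refine ⟨fun x => ?_, ?_⟩
  · exact ((hP.posSemidef x).smul ha).add ((hQ.posSemidef x).smul hb)
  · simp only [Pi.add_apply, Pi.smul_apply, Finset.sum_add_distrib, ← Finset.smul_sum,
      hP.sum_eq_one, hQ.sum_eq_one, ← add_smul, hab, one_smul]

theorem exists_isPOVM [Nonempty U] : ∃ P : U → Op A, IsPOVM P := by
  classical
  refine ⟨Pi.single (Classical.arbitrary U) 1, fun x => ?_, by simp⟩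
  rw [Pi.single_apply]
  split_ifs
  exacts [PosSemidef.one, PosSemidef.zero]

/-- The supremum defining the guessing probability is over a bounded set. -/
theorem le_guessProb (p : U → ℝ) (ρ : U → Op A) {P : U → Op A} (hP : IsPOVM P) :
    ∑ x, p x * ((ρ x * P x).trace).re ≤ guessProb p ρ := by
  refine le_csSup ?_ ⟨P, hP, rfl⟩
  have h : ContinuousOn (fun P : U → Op A => ∑ x, p x * ((ρ x * P x).trace).re)
      {P | IsPOVM P} := by
    refine Continuous.continuousOn ?_
    refine continuous_finsetSum _ fun x _ => continuous_const.mul ?_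
    exact Complex.continuous_re.comp (by fun_prop)
  refine (isCompact_setOf_isPOVM.bddAbove_image h).mono ?_
  rintro _ ⟨P, hP, rfl⟩
  exact ⟨P, hP, rfl⟩

theorem guessProb_le [Nonempty U] (p : U → ℝ) (ρ : U → Op A) {c : ℝ}
    (h : ∀ P : U → Op A, IsPOVM P → ∑ x, p x * ((ρ x * P x).trace).re ≤ c) :
    guessProb p ρ ≤ c := by
  obtain ⟨P, hP⟩ := exists_isPOVM (U := U) (A := A)
  refine csSup_le ⟨_, P, hP, rfl⟩ ?_
  rintro _ ⟨P, hP, rfl⟩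
  exact h P hP

theorem Ensemble.nonempty (E : Ensemble U A) : Nonempty U := by
  by_contra h
  rw [not_nonempty_iff] at h
  simpa using E.p_sum

/-- Post-processing by a channel cannot increase the guessing probability. -/
theorem IsChannel.guessProb_le {Φ : Op A →ₗ[ℂ] Op B} (hΦ : IsChannel Φ) [Nonempty U] (p : U → ℝ)
    (ρ : U → Op A) : guessProb p (fun x => Φ (ρ x)) ≤ guessProb p ρ := by
  refine Quantum.guessProb_le _ _ fun P hP => ?_
  obtain ⟨Q, hQ, h⟩ := hΦ.exists_isPOVM_pullback hP
  simp only [h]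
  exact le_guessProb p ρ hQ

/-! ### Separation of POVMs by ensembles -/

/-- Every real-linear functional on `ℂ^ι` is the real part of a complex-linear one. -/
theorem exists_real_functional_eq {ι : Type*} [Fintype ι] (f : (ι → ℂ) →ₗ[ℝ] ℝ) :
    ∃ g : ι → ℂ, ∀ y, f y = ∑ k, (g k * y k).re := by
  classical
  refine ⟨fun k => ⟨f (Pi.single k 1), -f (Pi.single k Complex.I)⟩, fun y => ?_⟩
  conv_lhs => rw [← Finset.univ_sum_single y]
  rw [map_sum]
  refine Finset.sum_congr rfl fun k _ => ?_
  have : (Pi.single k (y k) : ι → ℂ) =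
      (y k).re • (Pi.single k 1 : ι → ℂ) + (y k).im • (Pi.single k Complex.I : ι → ℂ) := by
    rw [← Pi.single_smul, ← Pi.single_smul, ← Pi.single_add]
    congr 1
    simp
  rw [this, map_add, map_smul, map_smul]
  simp
  ring

theorem sum_mul_trace_single (L : Op A →ₗ[ℂ] Op B) (G : Op A) (Q : Op B) :
    ∑ k : A × A, G k.1 k.2 * (L (single k.1 k.2 1) * Q).trace = (L G * Q).trace := by
  conv_rhs => rw [matrix_eq_sum_single G]
  simp only [map_sum, Finset.sum_mul, trace_sum, Fintype.sum_prod_type]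
  refine Finset.sum_congr rfl fun i _ => Finset.sum_congr rfl fun j _ => ?_
  rw [show single i j (G i j) = G i j • single i j (1 : ℂ) by simp, map_smul, smul_mul,
    trace_smul, smul_eq_mul]

/-- Only the Hermitian part of `G` is seen by Hermitian observables at the output of a channel. -/
theorem IsChannel.re_trace_hermitianPart_mul {L : Op A →ₗ[ℂ] Op B} (hL : IsChannel L) (G : Op A)
    {Q : Op B} (hQ : Q.IsHermitian) :
    (L ((1 / 2 : ℂ) • (G + Gᴴ)) * Q).trace.re = (L G * Q).trace.re := by
  have h : (L Gᴴ * Q).trace = star (L G * Q).trace := by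
    rw [hL.map_conjTranspose, ← trace_conjTranspose, conjTranspose_mul, hQ.eq, trace_mul_comm]
  rw [map_smul, map_add, smul_mul, trace_smul, Matrix.add_mul, trace_add, h]
  simp
  ring

/-- A finite family of Hermitian operators becomes, after adding one common multiple of the
identity and rescaling, the family `p x • ω x` of an ensemble. -/
theorem exists_ensemble_of_isHermitian [Nonempty U] [Nonempty A] (H : U → Op A)
    (hH : ∀ x, (H x).IsHermitian) :
    ∃ (E : Ensemble U A) (s t : ℝ), 0 < s ∧
      ∀ x, (E.p x : ℂ) • E.ω x = (s : ℂ) • (H x + (t : ℂ) • (1 : Op A)) := by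
  choose r hr0 hr using fun x => exists_posSemidef_add_smul_one (hH x)
  -- the extra `1` makes all the weights `τ x` positive
  set t : ℝ := ∑ x, r x + 1 with ht
  have hrt : ∀ x, r x + 1 ≤ t := fun x => by
    have := Finset.single_le_sum (f := r) (fun y _ => hr0 y) (Finset.mem_univ x)
    linarith
  set S : U → Op A := fun x => H x + (t : ℂ) • (1 : Op A) with hS
  have hSd : ∀ x, S x = (H x + (r x : ℂ) • (1 : Op A)) + ((t - r x : ℝ) : ℂ) • (1 : Op A) := by
    intro x
    rw [hS, add_assoc, ← add_smul]
    push_cast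
    congr 2
    ring
  have hpos : ∀ x, (S x).PosSemidef := fun x => by
    rw [hSd]
    exact (hr x).add (PosSemidef.one.smul (by
      exact_mod_cast (by linarith [hrt x] : (0 : ℝ) ≤ t - r x)))
  have htr : ∀ x, ((S x).trace.re : ℂ) = (S x).trace := fun x => by
    have := Complex.le_def.1 (hpos x).trace_nonneg
    exact Complex.ext rfl this.2
  set τ : U → ℝ := fun x => (S x).trace.re with hτ
  have hτpos : ∀ x, 0 < τ x := fun x => by
    have h1 : 0 ≤ (H x + (r x : ℂ) • (1 : Op A)).trace.re :=
      (Complex.le_def.1 (hr x).trace_nonneg).1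
    have h2 : τ x = (H x + (r x : ℂ) • (1 : Op A)).trace.re + (t - r x) * Fintype.card A := by
      rw [hτ]
      simp only
      rw [hSd, trace_add, Complex.add_re, trace_smul, trace_one, smul_eq_mul,
        ← Complex.ofReal_natCast, ← Complex.ofReal_mul, Complex.ofReal_re]
    have h3 : (0 : ℝ) < Fintype.card A := by exact_mod_cast Fintype.card_pos
    rw [h2]
    have := mul_pos (by linarith [hrt x] : (0 : ℝ) < t - r x) h3
    linarith
  have hT : 0 < ∑ x, τ x := Finset.sum_pos (fun x _ => hτpos x) Finset.univ_nonempty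
  refine ⟨⟨fun x => τ x / ∑ y, τ y, fun x => ((τ x)⁻¹ : ℂ) • S x,
    fun x => div_nonneg (hτpos x).le hT.le, ?_, fun x => ⟨?_, ?_⟩⟩,
    (∑ y, τ y)⁻¹, t, inv_pos.2 hT, fun x => ?_⟩
  · rw [← Finset.sum_div, div_self hT.ne']
  · exact (hpos x).smul (by exact_mod_cast (inv_pos.2 (hτpos x)).le)
  · have : (τ x : ℂ) ≠ 0 := by exact_mod_cast (hτpos x).ne'
    rw [trace_smul, ← htr, smul_eq_mul, inv_mul_cancel₀ this]
  · have : (τ x : ℂ) ≠ 0 := by exact_mod_cast (hτpos x).ne'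
    simp only [smul_smul]
    congr 1
    rw [div_eq_inv_mul]
    push_cast
    rw [mul_assoc, mul_inv_cancel₀ this, mul_one]

/-- The score of a POVM on the ensemble of `exists_ensemble_of_isHermitian`, seen through a
channel: an affine function of the score against the Hermitian operators themselves, with
coefficients independent of the channel and of the POVM. -/
theorem IsChannel.sum_score_eq {L : Op A →ₗ[ℂ] Op B} (hL : IsChannel L) {H : U → Op A}
    {E : Ensemble U A} {s t : ℝ}
    (hE : ∀ x, (E.p x : ℂ) • E.ω x = (s : ℂ) • (H x + (t : ℂ) • (1 : Op A)))
    {Q : U → Op B} (hQ : IsPOVM Q) :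
    ∑ x, E.p x * ((L (E.ω x) * Q x).trace).re =
      s * (∑ x, ((L (H x) * Q x).trace).re + t * Fintype.card A) := by
  have h1 : ∑ x, ((L 1 * Q x).trace).re = Fintype.card A := by
    rw [← Complex.re_sum, ← trace_sum, ← Finset.mul_sum, hQ.sum_eq_one, mul_one,
      hL.tracePreserving, trace_one, Complex.natCast_re]
  rw [← h1, Finset.mul_sum, ← Finset.sum_add_distrib, Finset.mul_sum]
  refine Finset.sum_congr rfl fun x _ => ?_
  have h2 := congr_arg (fun M => ((L M * Q x).trace).re) (hE x)
  simpa [Matrix.add_mul, mul_add] using h2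

/-- A functional of the data `Tr[L(E_ij) Q x]`, which determine the action of `Q` on inputs, is the
score of `Q` against a family of Hermitian operators. -/
theorem IsChannel.sum_functional_eq {L : Op A →ₗ[ℂ] Op B} (hL : IsChannel L)
    (g : U × A × A → ℂ) {Q : U → Op B} (hQ : IsPOVM Q) :
    ∑ k, (g k * (L (single k.2.1 k.2.2 1) * Q k.1).trace).re =
      ∑ x, ((L ((1 / 2 : ℂ) • (of (fun i j => g (x, i, j)) + (of fun i j => g (x, i, j))ᴴ)) *
        Q x).trace).re := by
  rw [Fintype.sum_prod_type]
  refine Finset.sum_congr rfl fun x _ => ?_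
  rw [hL.re_trace_hermitianPart_mul _ (hQ.posSemidef x).1, ← sum_mul_trace_single, Complex.re_sum]
  rfl

/-- If `L` is `U`-sufficient for `L'`, then every POVM at the output of `L'` is simulated, on all
inputs, by a POVM at the output of `L`. Otherwise the family of functionals induced by `P` would
be separated by a hyperplane from the compact convex set of those induced by POVMs after `L`, and
the normal of that hyperplane yields an ensemble on which `L'` has the larger guessing
probability. -/
theorem Sufficient.exists_isPOVM [Nonempty U] [Nonempty A] {L : Op A →ₗ[ℂ] Op B}
    {L' : Op A →ₗ[ℂ] Op B'} (h : Sufficient U L L') (hL : IsChannel L) (hL' : IsChannel L')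
    {P : U → Op B'} (hP : IsPOVM P) :
    ∃ Q : U → Op B, IsPOVM Q ∧ ∀ x X, (L' X * P x).trace = (L X * Q x).trace := by
  -- a POVM after `L` acts on inputs through its values on the matrix units
  let D : (U → Op B) →ₗ[ℝ] (U × A × A → ℂ) :=
    { toFun := fun Q k => (L (single k.2.1 k.2.2 1) * Q k.1).trace
      map_add' := fun Q R => by ext k; simp [Matrix.mul_add]
      map_smul' := fun c Q => by ext k; simp }
  let d : U × A × A → ℂ := fun k => (L' (single k.2.1 k.2.2 1) * P k.1).trace
  by_cases hd : d ∈ D '' {Q | IsPOVM Q}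
  · obtain ⟨Q, hQ, hQd⟩ := hd
    refine ⟨Q, hQ, fun x X => ?_⟩
    rw [← sum_mul_trace_single L', ← sum_mul_trace_single L]
    refine Finset.sum_congr rfl fun k _ => ?_
    congr 1
    exact (congr_fun hQd (x, k)).symm
  exfalso
  have hDc : Continuous D := by
    refine continuous_pi fun k => ?_
    change Continuous fun Q : U → Op B => (L (single k.2.1 k.2.2 1) * Q k.1).trace
    fun_prop
  obtain ⟨f, c, hf, hc⟩ := geometric_hahn_banach_closed_point
    (convex_setOf_isPOVM.linear_image D) (isCompact_setOf_isPOVM.image hDc).isClosed hd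
  obtain ⟨g, hg⟩ := exists_real_functional_eq f.toLinearMap
  let G : U → Op A := fun x => of fun i j => g (x, i, j)
  let H : U → Op A := fun x => (1 / 2 : ℂ) • (G x + (G x)ᴴ)
  have hH : ∀ x, (H x).IsHermitian := fun x => by
    simp [H, IsHermitian, conjTranspose_smul, add_comm]
  obtain ⟨E, s, t, hs, hE⟩ := exists_ensemble_of_isHermitian H hH
  have hP' : c < ∑ x, ((L' (H x) * P x).trace).re := by
    rw [← hL'.sum_functional_eq g hP, ← hg]
    exact hc
  have hQ' : ∀ Q : U → Op B, IsPOVM Q → ∑ x, ((L (H x) * Q x).trace).re ≤ c := fun Q hQ => by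
    rw [← hL.sum_functional_eq g hQ, ← hg]
    exact (hf _ ⟨Q, hQ, rfl⟩).le
  have h1 : guessProb E.p (fun x => L (E.ω x)) ≤ s * (c + t * Fintype.card A) :=
    guessProb_le _ _ fun Q hQ => by
      rw [hL.sum_score_eq hE hQ]
      gcongr
      exact hQ' Q hQ
  have h2 := le_guessProb E.p (fun x => L' (E.ω x)) hP
  rw [hL'.sum_score_eq hE hP] at h2
  have h3 : s * (c + t * Fintype.card A) <
      s * (∑ x, ((L' (H x) * P x).trace).re + t * Fintype.card A) := by
    gcongr
  exact absurd (h E) (by linarith)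

end

/-! ### Teleportation -/

section

variable {A B B' C U : Type*}
  [Fintype A] [DecidableEq A] [Fintype B] [DecidableEq B] [Fintype B'] [DecidableEq B']
  [Fintype C] [DecidableEq C] [Fintype U]

/-- An orthogonal operator basis of `d ^ 2` unitaries between `d`-dimensional spaces. With both
bases labelled by `ZMod d`, these are the Heisenberg–Weyl operators, which send `e j` to
`χ (b * j) • e (j + a)` for `a b : ZMod d` and a primitive additive character `χ`. -/
theorem exists_unitary_basis [Nonempty C] (hBC : Fintype.card C = Fintype.card B)
    (hU : Fintype.card U = Fintype.card B ^ 2) :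
    ∃ V : U → Matrix B C ℂ, (∀ x, (V x)ᴴ * V x = 1) ∧ (∀ x, V x * (V x)ᴴ = 1) ∧
      ∀ i j k l, ∑ x, V x i j * star (V x k l) =
        if i = k ∧ j = l then (Fintype.card B : ℂ) else 0 := by
  have : NeZero (Fintype.card B) := ⟨by rw [← hBC]; exact Fintype.card_ne_zero⟩
  let eB : B ≃ ZMod (Fintype.card B) := Fintype.equivOfCardEq (by rw [ZMod.card])
  let eC : C ≃ ZMod (Fintype.card B) := Fintype.equivOfCardEq (by rw [ZMod.card, hBC])
  let eU : U ≃ ZMod (Fintype.card B) × ZMod (Fintype.card B) :=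
    Fintype.equivOfCardEq (by rw [Fintype.card_prod, ZMod.card, hU, sq])
  let χ : AddChar (ZMod (Fintype.card B)) ℂ := ZMod.stdAddChar
  have hχ : ∀ x y, χ x * star (χ y) = χ (x - y) := fun x y => by
    rw [sub_eq_add_neg, AddChar.map_add_eq_mul, AddChar.map_neg_eq_conj]
    rfl
  let V : U → Matrix B C ℂ := fun x => of fun i j =>
    if eB i = eC j + (eU x).1 then χ ((eU x).2 * eC j) else 0
  have h1 : ∀ x, (V x)ᴴ * V x = 1 := fun x => by
    ext j l
    rw [Matrix.mul_apply, ← eB.symm.sum_comp]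
    simp only [V, conjTranspose_apply, of_apply, Equiv.apply_symm_apply, apply_ite star, star_zero,
      ite_mul, zero_mul, mul_ite, mul_zero, Finset.sum_ite_eq', Finset.mem_univ, if_true,
      add_left_inj, eC.injective.eq_iff, Matrix.one_apply]
    by_cases h : j = l
    · simp only [h, if_true]
      rw [mul_comm, hχ, sub_self, AddChar.map_zero_eq_one]
    · simp [h, Ne.symm h]
  refine ⟨V, h1, fun x => (mul_eq_one_comm_of_card_eq C B ℂ hBC).1 (h1 x), fun i j k l => ?_⟩
  rw [← eU.symm.sum_comp, Fintype.sum_prod_type]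
  have h2 : ∀ a b, V (eU.symm (a, b)) i j * star (V (eU.symm (a, b)) k l) =
      if eB i = eC j + a ∧ eB k = eC l + a then χ (b * (eC j - eC l)) else 0 := fun a b => by
    simp only [V, of_apply, Equiv.apply_symm_apply, apply_ite star, star_zero, mul_sub, ← hχ]
    split_ifs <;> simp_all
  simp only [h2]
  -- orthogonality of the characters `b ↦ χ (b * j)` singles out `j = l`
  have h3 : ∀ a, (∑ b, if eB i = eC j + a ∧ eB k = eC l + a then χ (b * (eC j - eC l)) else 0) =
      if i = k ∧ j = l ∧ a = eB i - eC j then (Fintype.card B : ℂ) else 0 := fun a => by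
    by_cases h : eB i = eC j + a ∧ eB k = eC l + a
    · simp only [h, and_self, if_true]
      rw [AddChar.sum_mulShift _ (ZMod.isPrimitive_stdAddChar _), ZMod.card]
      simp only [sub_eq_zero, eC.injective.eq_iff]
      by_cases hjl : j = l
      · subst hjl
        have : i = k := eB.injective (h.1.trans h.2.symm)
        simp [this, add_sub_cancel_left]
      · simp [hjl]
    · simp only [h, if_false, Finset.sum_const_zero]
      rw [if_neg]
      rintro ⟨rfl, rfl, rfl⟩
      exact h ⟨by abel, by abel⟩
  simp only [h3]
  by_cases h : i = k ∧ j = l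
  · simp [h.1, h.2]
  · rw [if_neg h]
    refine Finset.sum_eq_zero fun a _ => if_neg fun ha => h ⟨ha.1, ha.2.1⟩

/-- The transposed partial trace of `(1 ⊗ ρ) * Q` over the second factor. Up to normalization it is
the state of the partner of `C` in a maximally entangled pair after the effect `Q` has been
observed on `C` and a system in state `ρ`; this is where the transposition comes from. -/
def contract (Q : Op (C × B)) : Op B →ₗ[ℂ] Op C where
  toFun ρ := of fun i k => ((single i k 1 ⊗ₖ ρ) * Q).trace
  map_add' X Y := by ext; simp [kronecker_add, Matrix.add_mul]
  map_smul' c X := by ext; simp [kronecker_smul]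

theorem contract_apply (Q : Op (C × B)) (ρ : Op B) (i k : C) :
    contract Q ρ i k = ((single i k 1 ⊗ₖ ρ) * Q).trace := rfl

theorem contract_apply_eq_sum (Q : Op (C × B)) (ρ : Op B) (i k : C) :
    contract Q ρ i k = ∑ b, ∑ b', ρ b b' * Q (k, b') (i, b) := by
  simp [contract_apply, trace, Matrix.mul_apply, Fintype.sum_prod_type, single_apply, ite_and]

/-- The transposition in `contract` makes it completely positive: its Choi matrix is, up to a
transposition, `Q` itself. -/
theorem exists_krausMap_contract {Q : Op (C × B)} (hQ : Q.PosSemidef) :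
    ∃ K : C × B → Matrix C B ℂ, contract Q = krausMap K := by
  obtain ⟨R, rfl⟩ := exists_conjTranspose_mul_self_eq hQ
  refine ⟨fun m => of fun i b => R m (i, b), ?_⟩
  refine LinearMap.ext fun ρ => ?_
  ext i k
  rw [contract_apply_eq_sum, krausMap_apply]
  simp only [Matrix.sum_apply, Matrix.mul_apply, Finset.mul_sum, Finset.sum_mul, of_apply,
    conjTranspose_apply]
  rw [Finset.sum_congr rfl fun b _ => Finset.sum_comm, Finset.sum_comm]
  refine Finset.sum_congr rfl fun m _ => ?_
  rw [Finset.sum_comm]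
  refine Finset.sum_congr rfl fun b _ => Finset.sum_congr rfl fun b' _ => ?_
  ring

theorem sum_trace_contract {Q : U → Op (C × B)} (hQ : IsPOVM Q) (ρ : Op B) :
    ∑ x, (contract (Q x) ρ).trace = Fintype.card C * ρ.trace := by
  have h : ∀ x, (contract (Q x) ρ).trace = (((1 : Op C) ⊗ₖ ρ) * Q x).trace := fun x => by
    simp [contract_apply_eq_sum, trace, Matrix.mul_apply, Fintype.sum_prod_type, one_apply]
  simp only [h]
  rw [← trace_sum, ← Finset.mul_sum, hQ.sum_eq_one, mul_one, trace_kronecker, trace_one]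

/-- Measuring `Q` jointly on the input and on half of a maximally entangled pair, and applying to
the other half the unitary `V x` prescribed by the outcome `x`. -/
noncomputable def teleport (V : U → Matrix B' C ℂ) (Q : U → Op (C × B)) : Op B →ₗ[ℂ] Op B' :=
  (Fintype.card C : ℂ)⁻¹ • ∑ x, krausMap (fun _ : Unit => V x) ∘ₗ contract (Q x)

theorem teleport_apply (V : U → Matrix B' C ℂ) (Q : U → Op (C × B)) (ρ : Op B) :
    teleport V Q ρ = (Fintype.card C : ℂ)⁻¹ • ∑ x, V x * contract (Q x) ρ * (V x)ᴴ := by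
  simp [teleport, krausMap_apply]

theorem isChannel_teleport [Nonempty C] {V : U → Matrix B' C ℂ} (hV : ∀ x, (V x)ᴴ * V x = 1)
    {Q : U → Op (C × B)} (hQ : IsPOVM Q) : IsChannel (teleport V Q) := by
  choose K hK using fun x => exists_krausMap_contract (hQ.posSemidef x)
  -- each Kraus operator absorbs a square root of the prefactor of `teleport`
  have hc : ((√(Fintype.card C : ℝ)⁻¹ : ℝ) : ℂ) * ((√(Fintype.card C : ℝ)⁻¹ : ℝ) : ℂ) =
      (Fintype.card C : ℂ)⁻¹ := by
    rw [← Complex.ofReal_mul, Real.mul_self_sqrt (by positivity)]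
    simp
  have h : teleport V Q = krausMap fun m : U × (C × B) =>
      ((√(Fintype.card C : ℝ)⁻¹ : ℝ) : ℂ) • (V m.1 * K m.1 m.2) := by
    refine LinearMap.ext fun ρ => ?_
    simp only [teleport_apply, hK, krausMap_apply, Fintype.sum_prod_type, conjTranspose_smul,
      smul_mul, Matrix.mul_smul, smul_smul, RCLike.star_def, Complex.conj_ofReal, hc,
      Finset.smul_sum, Matrix.mul_sum, Matrix.sum_mul, conjTranspose_mul, Matrix.mul_assoc]
  rw [h]
  refine isChannel_krausMap _ fun ρ => ?_
  rw [← h, teleport_apply, trace_smul, trace_sum]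
  have h2 : ∀ x, (V x * contract (Q x) ρ * (V x)ᴴ).trace = (contract (Q x) ρ).trace := fun x => by
    rw [trace_mul_comm, ← Matrix.mul_assoc, hV, one_mul]
  simp only [h2]
  rw [sum_trace_contract hQ, smul_eq_mul, inv_mul_cancel_left₀]
  exact_mod_cast Fintype.card_ne_zero

/-- The measurement in the maximally entangled basis associated with the unitaries `V x`. -/
noncomputable def bellMeasurement (V : U → Matrix B' C ℂ) (x : U) : Op (C × B') :=
  (Fintype.card C : ℂ)⁻¹ • vecMulVec (fun p => V x p.2 p.1) (star fun p => V x p.2 p.1)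

theorem isPOVM_bellMeasurement [Nonempty C] {V : U → Matrix B' C ℂ}
    (hV : ∀ i j k l, ∑ x, V x i j * star (V x k l) =
      if i = k ∧ j = l then (Fintype.card C : ℂ) else 0) : IsPOVM (bellMeasurement V) where
  posSemidef x := (posSemidef_vecMulVec_self_star _).smul (by
    rw [← Complex.ofReal_natCast, ← Complex.ofReal_inv]
    exact_mod_cast (by positivity : (0 : ℝ) ≤ (Fintype.card C : ℝ)⁻¹))
  sum_eq_one := by
    have hc : (Fintype.card C : ℂ) ≠ 0 := by exact_mod_cast Fintype.card_ne_zero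
    ext ⟨j, i⟩ ⟨l, k⟩
    simp only [bellMeasurement, Matrix.sum_apply, Matrix.smul_apply, vecMulVec_apply,
      Pi.star_apply, ← Finset.smul_sum, hV, one_apply, Prod.mk.injEq, and_comm (a := j = l)]
    split_ifs <;> simp [hc]

theorem contract_bellMeasurement (V : U → Matrix B' C ℂ) (x : U) (ρ : Op B') :
    contract (bellMeasurement V x) ρ = (Fintype.card C : ℂ)⁻¹ • ((V x)ᴴ * ρ * V x) := by
  ext i k
  simp only [contract_apply_eq_sum, bellMeasurement, Matrix.smul_apply, vecMulVec_apply,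
    Pi.star_apply, Matrix.mul_apply, conjTranspose_apply, smul_eq_mul, Finset.mul_sum,
    Finset.sum_mul]
  rw [Finset.sum_comm]
  refine Finset.sum_congr rfl fun b' _ => Finset.sum_congr rfl fun b _ => ?_
  ring

/-- Teleportation with the Bell measurement transmits the state perfectly. -/
theorem teleport_bellMeasurement [Nonempty C] {V : U → Matrix B' C ℂ}
    (hV : ∀ x, V x * (V x)ᴴ = 1) (hU : Fintype.card U = Fintype.card C ^ 2) :
    teleport V (bellMeasurement V) = LinearMap.id := by
  refine LinearMap.ext fun ρ => ?_
  have h : ∀ x, V x * ((V x)ᴴ * ρ * V x) * (V x)ᴴ = ρ := fun x => by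
    rw [← Matrix.mul_assoc, ← Matrix.mul_assoc, hV, one_mul, Matrix.mul_assoc, hV, mul_one]
  have hc : (Fintype.card C : ℂ) ≠ 0 := by exact_mod_cast Fintype.card_ne_zero
  simp only [teleport_apply, contract_bellMeasurement, Matrix.mul_smul, smul_mul, h,
    Finset.sum_const, Finset.card_univ, hU, LinearMap.id_apply, ← Nat.cast_smul_eq_nsmul ℂ,
    smul_smul]
  convert one_smul ℂ ρ
  push_cast
  field_simp

/-- The channel `Ψ` is teleportation in which the Bell measurement on `C × B'` is replaced by a
measurement `Q` on `C × B` simulating it. Since `Υ` is surjective, `Q` simulates the Bell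
measurement with no channel acting on the auxiliary system. -/
theorem Sufficient.exists_isChannel_comp [Nonempty A] [Nonempty C]
    (hC : Fintype.card C = Fintype.card B') (hU : Fintype.card U = Fintype.card B' ^ 2)
    {Φ : Op A →ₗ[ℂ] Op B} (hΦ : IsChannel Φ) {Φ' : Op A →ₗ[ℂ] Op B'} (hΦ' : IsChannel Φ')
    {Υ : Op C →ₗ[ℂ] Op C} (hΥ : IsCompleteChannel Υ)
    (h : Sufficient U (tensorMap Υ Φ) (tensorMap Υ Φ')) :
    ∃ Ψ : Op B →ₗ[ℂ] Op B', IsChannel Ψ ∧ Φ' = Ψ ∘ₗ Φ := by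
  obtain ⟨V, hV1, hV2, hV3⟩ := exists_unitary_basis hC hU
  rw [← hC] at hU hV3
  have : Nonempty U := Fintype.card_pos_iff.1 (by rw [hU]; exact pow_pos Fintype.card_pos 2)
  obtain ⟨Q, hQ, hPQ⟩ := h.exists_isPOVM (hΥ.toIsChannel.tensorMap hΦ)
    (hΥ.toIsChannel.tensorMap hΦ') (isPOVM_bellMeasurement hV3)
  -- `Υ` is surjective, so the matrix units entering `contract` are outputs of `Υ`
  refine ⟨teleport V Q, isChannel_teleport hV1 hQ, LinearMap.ext fun X => ?_⟩
  have hcon : ∀ x, contract (bellMeasurement V x) (Φ' X) = contract (Q x) (Φ X) := fun x => by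
    ext i k
    obtain ⟨Z, hZ⟩ := hΥ.bijective.2 (single i k 1)
    have := hPQ x (Z ⊗ₖ X)
    rwa [tensorMap_kronecker, tensorMap_kronecker, hZ] at this
  rw [LinearMap.comp_apply, teleport_apply]
  simp only [← hcon]
  rw [← teleport_apply, teleport_bellMeasurement hV2 hU, LinearMap.id_apply]

theorem Sufficient.of_comp {Φ : Op A →ₗ[ℂ] Op B} {Φ' : Op A →ₗ[ℂ] Op B'} {Ψ : Op B →ₗ[ℂ] Op B'}
    (hΨ : IsChannel Ψ) (h : Φ' = Ψ ∘ₗ Φ) (Υ : Op C →ₗ[ℂ] Op C) :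
    Sufficient U (tensorMap Υ Φ) (tensorMap Υ Φ') := fun E => by
  have := E.nonempty
  have h2 : tensorMap Υ Φ' = tensorMap LinearMap.id Ψ ∘ₗ tensorMap Υ Φ := by
    rw [← tensorMap_comp, h, LinearMap.id_comp]
  rw [h2]
  exact (isChannel_id.tensorMap hΨ).guessProb_le E.p _

end

/-! ### Measure-and-prepare channels -/

section

variable {A B B' C U : Type*}
  [Fintype A] [DecidableEq A] [Fintype B] [DecidableEq B] [Fintype B'] [DecidableEq B']
  [Fintype C] [DecidableEq C] [Fintype U]

/-- The map `X ↦ ∑ i, Tr[X P i] σ i`. -/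
def measurePrepare {ι : Type*} [Fintype ι] (P : ι → Op A) (σ : ι → Op B) : Op A →ₗ[ℂ] Op B where
  toFun X := ∑ i, (X * P i).trace • σ i
  map_add' X Y := by simp [Matrix.add_mul, add_smul, Finset.sum_add_distrib]
  map_smul' c X := by simp [Finset.smul_sum, smul_smul]

theorem measurePrepare_apply {ι : Type*} [Fintype ι] (P : ι → Op A) (σ : ι → Op B) (X : Op A) :
    measurePrepare P σ X = ∑ i, (X * P i).trace • σ i := rfl

theorem isMeasureAndPrepare_measurePrepare {ι : Type*} [Fintype ι] {P : ι → Op A}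
    {σ : ι → Op B} (hP : IsPOVM P) (hσ : ∀ i, IsState (σ i)) :
    IsMeasureAndPrepare (measurePrepare P σ) := by
  let e := (Fintype.equivFin ι).symm
  refine ⟨Fintype.card ι, P ∘ e, σ ∘ e, ⟨fun i => hP.posSemidef _, ?_⟩, fun i => hσ _, fun X => ?_⟩
  · rw [← hP.sum_eq_one]
    exact e.sum_comp P
  · exact (e.sum_comp fun i => (X * P i).trace • σ i).symm

/-- The Kraus operators of `X ↦ Tr[X P] σ` come from square roots of `P` and `σ`. -/
theorem isChannel_measurePrepare {ι : Type*} [Fintype ι] {P : ι → Op A}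
    {σ : ι → Op B} (hP : IsPOVM P) (hσ : ∀ i, IsState (σ i)) :
    IsChannel (measurePrepare P σ) := by
  choose R hR using fun i => exists_conjTranspose_mul_self_eq (hP.posSemidef i)
  choose S hS using fun i => exists_conjTranspose_mul_self_eq (hσ i).posSemidef
  have h : measurePrepare P σ = krausMap fun k : ι × B × A =>
      of fun b a => star (S k.1 k.2.1 b) * R k.1 k.2.2 a := by
    refine LinearMap.ext fun X => ?_
    rw [measurePrepare_apply, krausMap_apply, Fintype.sum_prod_type]
    refine Finset.sum_congr rfl fun i _ => ?_
    ext b c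
    have h1 : ∀ k : B × A, ((of fun b a => star (S i k.1 b) * R i k.2 a : Matrix B A ℂ) * X *
        (of fun b a => star (S i k.1 b) * R i k.2 a : Matrix B A ℂ)ᴴ) b c =
          (star (S i k.1 b) * S i k.1 c) * (R i * X * (R i)ᴴ) k.2 k.2 := fun k => by
      simp only [Matrix.mul_apply, of_apply, conjTranspose_apply, star_mul', star_star,
        Finset.mul_sum, Finset.sum_mul]
      refine Finset.sum_congr rfl fun a _ => Finset.sum_congr rfl fun a' _ => ?_
      ring
    rw [Matrix.sum_apply]
    simp only [h1, Fintype.sum_prod_type, ← Finset.mul_sum, ← Finset.sum_mul]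
    rw [hR, hS, ← Matrix.mul_assoc, trace_mul_comm, ← Matrix.mul_assoc, Matrix.smul_apply,
      smul_eq_mul, mul_comm]
    rfl
  rw [h]
  refine isChannel_krausMap _ fun X => ?_
  rw [← h, measurePrepare_apply, trace_sum]
  simp only [trace_smul, (hσ _).trace_eq_one, smul_eq_mul, mul_one]
  rw [← trace_sum, ← Matrix.mul_sum, hP.sum_eq_one, mul_one]

/-- The pure states along `e i + s • e j` with `s = 1, i, -1, -i` for `i ≠ j`, and along `e i` for
`i = j`. -/
noncomputable def probeState (k : A × A × Fin 4) : Op A :=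
  (1 / 2 : ℂ) • (single k.1 k.1 1 + single k.2.1 k.2.1 1 + if k.1 = k.2.1 then 0 else
    (star (Complex.I ^ (k.2.2 : ℕ)) • single k.1 k.2.1 1 +
      Complex.I ^ (k.2.2 : ℕ) • single k.2.1 k.1 1))

theorem isState_single (i : A) : IsState (single i i 1 : Op A) where
  posSemidef := by
    have h := posSemidef_vecMulVec_self_star (Pi.single i (1 : ℂ))
    convert h using 1
    rw [← Pi.single_star, star_one, single_eq_single_vecMulVec_single]
  trace_eq_one := by simp

theorem isState_probeState (k : A × A × Fin 4) : IsState (probeState k) := by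
  obtain ⟨i, j, s⟩ := k
  by_cases hij : i = j
  · subst hij
    convert isState_single i using 1
    simp only [probeState, if_true, add_zero, ← two_smul ℂ (single i i (1 : ℂ)), smul_smul]
    norm_num
  have hs : star (Complex.I ^ (s : ℕ)) * Complex.I ^ (s : ℕ) = 1 := by
    rw [star_pow, ← mul_pow]
    simp
  refine ⟨?_, by simp [probeState, hij, Ne.symm hij, trace_single_eq_of_ne]; norm_num⟩
  have h := posSemidef_vecMulVec_self_star
    (Pi.single i (1 : ℂ) + Complex.I ^ (s : ℕ) • Pi.single j (1 : ℂ))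
  convert h.smul (by norm_num [Complex.le_def] : (0 : ℂ) ≤ 1 / 2) using 1
  rw [probeState, star_add, star_smul, ← Pi.single_star, ← Pi.single_star, star_one]
  simp only [add_vecMulVec, vecMulVec_add, smul_vecMulVec, vecMulVec_smul,
    ← single_eq_single_vecMulVec_single, smul_add, smul_smul, hij, if_false, hs]
  module

/-- Averaging over the four phases removes the off-diagonal terms. -/
theorem sum_probeState : ∑ k : A × A × Fin 4, probeState k = (4 * Fintype.card A : ℂ) • 1 := by
  have h3 : ∑ k : A, single k k (1 : ℂ) = 1 := by
    ext i j
    simp [Matrix.sum_apply, single_apply, one_apply, ite_and]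
  have h : ∀ i j : A, ∑ s : Fin 4, probeState (i, j, s) =
      (2 : ℂ) • (single i i 1 + single j j 1) := fun i j => by
    have hI : Complex.I ^ 3 = -Complex.I := Complex.I_pow_three
    by_cases hij : i = j
    · simp only [probeState, hij, if_true, Fin.sum_univ_four]
      module
    · simp only [probeState, hij, if_false, Fin.sum_univ_four, Fin.val_zero, Fin.val_one,
        Fin.val_two, show ((3 : Fin 4) : ℕ) = 3 from rfl, pow_zero, pow_one, Complex.I_sq, hI,
        star_one, star_neg]
      module
  simp only [Fintype.sum_prod_type, h, ← Finset.smul_sum, Finset.sum_add_distrib, h3,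
    Finset.sum_const, Finset.card_univ, ← Nat.cast_smul_eq_nsmul ℂ, smul_smul, ← two_smul ℂ]
  congr 1
  ring

/-- The states `probeState` span the operator space. -/
theorem eq_zero_of_trace_mul_probeState {X : Op A}
    (h : ∀ k, (X * probeState k).trace = 0) : X = 0 := by
  have hd : ∀ i, X i i = 0 := fun i => by
    -- `probeState (i, i, 0)` is the projection onto `e i`
    have := h (i, i, 0)
    simpa [probeState, Matrix.mul_add, trace_mul_single, ← two_smul ℂ] using this
  ext i j
  by_cases hij : i = j
  · rw [← hij, hd, Matrix.zero_apply]
  -- the phases `1` and `i` give the sum and the difference of `X i j` and `X j i`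
  have h0 := h (i, j, 0)
  have h1 := h (i, j, 1)
  simp [probeState, hij, Matrix.mul_add, trace_mul_single, hd] at h0 h1
  rw [Matrix.zero_apply]
  linear_combination h0 - Complex.I * h1 + (X i j / 2 - X j i / 2) * Complex.I_sq

/-- Measuring the (rescaled) states `probeState` and preparing the same state is self-adjoint and
positive definite for the Hilbert–Schmidt inner product, because these states span. -/
theorem exists_isCompleteChannel_isMeasureAndPrepare [Nonempty A] :
    ∃ Υ : Op A →ₗ[ℂ] Op A, IsCompleteChannel Υ ∧ IsMeasureAndPrepare Υ := by
  have hc : (4 * Fintype.card A : ℂ) ≠ 0 :=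
    mul_ne_zero (by norm_num) (by exact_mod_cast Fintype.card_ne_zero)
  have hP : IsPOVM fun k : A × A × Fin 4 => (4 * Fintype.card A : ℂ)⁻¹ • probeState k := by
    refine ⟨fun k => (isState_probeState k).posSemidef.smul ?_, ?_⟩
    · have : (0 : ℝ) ≤ (4 * Fintype.card A : ℝ)⁻¹ := by positivity
      have h2 := Complex.zero_le_real.2 this
      push_cast at h2
      exact h2
    · rw [← Finset.smul_sum, sum_probeState, smul_smul, inv_mul_cancel₀ hc, one_smul]
  refine ⟨_, ⟨isChannel_measurePrepare hP isState_probeState, ?_⟩,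
    isMeasureAndPrepare_measurePrepare hP isState_probeState⟩
  have hinj : Function.Injective (measurePrepare
      (fun k : A × A × Fin 4 => (4 * Fintype.card A : ℂ)⁻¹ • probeState k) probeState) := by
    rw [injective_iff_map_eq_zero]
    intro X hX
    have hX' : ∑ k, (X * probeState k).trace • probeState k = 0 := by
      have h : ∀ k, (X * (4 * Fintype.card A : ℂ)⁻¹ • probeState k).trace • probeState k =
          (4 * Fintype.card A : ℂ)⁻¹ • ((X * probeState k).trace • probeState k) := fun k => by
        rw [Matrix.mul_smul, trace_smul, smul_assoc]
      simp only [measurePrepare_apply, h, ← Finset.smul_sum] at hX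
      exact (smul_eq_zero.1 hX).resolve_left (inv_ne_zero hc)
    -- pair with `X` in the Hilbert–Schmidt inner product
    have hsum : ∑ k, ‖(X * probeState k).trace‖ ^ 2 = 0 := by
      have h := congr_arg (fun M => (Xᴴ * M).trace) hX'
      have hst : ∀ k, (Xᴴ * probeState k).trace = star (X * probeState k).trace := fun k => by
        rw [← trace_conjTranspose, conjTranspose_mul, (isState_probeState k).posSemidef.1.eq,
          trace_mul_comm]
      simp only [Matrix.mul_sum, trace_sum, Matrix.mul_smul, trace_smul, hst, smul_eq_mul,
        Matrix.mul_zero, trace_zero, RCLike.star_def, Complex.mul_conj'] at h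
      exact_mod_cast h
    refine eq_zero_of_trace_mul_probeState fun k => ?_
    have := (Finset.sum_eq_zero_iff_of_nonneg fun k _ => sq_nonneg _).1 hsum k (Finset.mem_univ k)
    simpa using this
  exact ⟨hinj, LinearMap.injective_iff_surjective.1 hinj⟩

/-! ### Separable probe states -/

/-- A positive semidefinite operator is its trace times a state, also when the trace is zero. -/
theorem exists_isState_smul_eq [Nonempty A] {M : Op A} (hM : M.PosSemidef) :
    ∃ τ, IsState τ ∧ M = (M.trace.re : ℂ) • τ := by
  have htr : (M.trace.re : ℂ) = M.trace :=
    Complex.ext rfl (Complex.le_def.1 hM.trace_nonneg).2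
  by_cases h : M.trace = 0
  · exact ⟨_, isState_single (Classical.arbitrary A), by
      rw [htr, h, zero_smul, hM.trace_eq_zero_iff.1 h]⟩
  · refine ⟨(M.trace.re : ℂ)⁻¹ • M, ⟨hM.smul ?_, ?_⟩, ?_⟩
    · exact_mod_cast inv_nonneg.2 (Complex.le_def.1 hM.trace_nonneg).1
    · rw [htr, trace_smul, smul_eq_mul, inv_mul_cancel₀ h]
    · rw [htr, smul_smul, mul_inv_cancel₀ h, one_smul]

/-- The unnormalized state of the second system conditional on an effect `P` on the first. -/
theorem exists_krausMap_kronecker_eq {P : Op C} (hP : P.PosSemidef) :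
    ∃ K : C → Matrix A (C × A) ℂ, ∀ Y Z, krausMap K (Y ⊗ₖ Z) = (Y * P).trace • Z := by
  obtain ⟨R, rfl⟩ := exists_conjTranspose_mul_self_eq hP
  refine ⟨fun m => of fun a p => if a = p.2 then R m p.1 else 0, fun Y Z => ?_⟩
  ext a b
  simp only [krausMap_apply, Matrix.sum_apply, Matrix.mul_apply, of_apply, conjTranspose_apply,
    Fintype.sum_prod_type, kroneckerMap_apply, apply_ite star, star_zero, ite_mul, zero_mul,
    mul_ite, mul_zero, Finset.sum_ite_eq, Finset.mem_univ, if_true, Matrix.smul_apply, smul_eq_mul,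
    trace, diag_apply, Finset.sum_mul, Finset.mul_sum]
  rw [Finset.sum_comm, Finset.sum_congr rfl fun c' _ => Finset.sum_comm, Finset.sum_comm]
  refine Finset.sum_congr rfl fun c _ => Finset.sum_congr rfl fun c' _ =>
    Finset.sum_congr rfl fun m _ => ?_
  ring

/-- A measure-and-prepare channel acting on one of two systems breaks entanglement. -/
theorem IsMeasureAndPrepare.isSeparable [Nonempty A] {Υ : Op C →ₗ[ℂ] Op B}
    (h : IsMeasureAndPrepare Υ) {ω : Op (C × A)} (hω : IsState ω) :
    IsSeparable (tensorMap Υ (LinearMap.id : Op A →ₗ[ℂ] Op A) ω) := by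
  obtain ⟨n, P, σ, hP, hσ, hΥ⟩ := h
  choose K hK using fun i => exists_krausMap_kronecker_eq (A := A) (hP.posSemidef i)
  have h1 : tensorMap Υ (LinearMap.id : Op A →ₗ[ℂ] Op A) ω = ∑ i, σ i ⊗ₖ krausMap (K i) ω := by
    let f : Op (C × A) →ₗ[ℂ] Op (B × A) :=
      ∑ i, kroneckerBilinear (R := ℂ) (σ i) ∘ₗ krausMap (K i)
    have hf : tensorMap Υ (LinearMap.id : Op A →ₗ[ℂ] Op A) = f :=
      linearMap_ext_kronecker fun Y Z => by
        ext ⟨a, b⟩ ⟨c, d⟩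
        have hf' : f (Y ⊗ₖ Z) = ∑ i, σ i ⊗ₖ krausMap (K i) (Y ⊗ₖ Z) := by
          simp only [f, LinearMap.sum_apply]
          rfl
        simp only [hf', tensorMap_kronecker, hK, hΥ, Matrix.sum_apply, kroneckerMap_apply,
          Matrix.smul_apply, smul_eq_mul, Finset.sum_mul, LinearMap.id_apply]
        refine Finset.sum_congr rfl fun i _ => ?_
        ring
    rw [hf]
    simp only [f, LinearMap.sum_apply]
    rfl
  choose τ hτ hKτ using fun i =>
    exists_isState_smul_eq (krausMap_posSemidef (K i) hω.posSemidef)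
  refine ⟨n, fun i => (krausMap (K i) ω).trace.re, σ, τ, fun i => ?_, ?_, hσ, hτ, ?_⟩
  · exact (Complex.le_def.1 (krausMap_posSemidef (K i) hω.posSemidef).trace_nonneg).1
  · have hmp : Υ = measurePrepare P σ := LinearMap.ext hΥ
    have h2 := (((isChannel_measurePrepare hP hσ).tensorMap (isChannel_id (A := A))).map_isState
      hω).trace_eq_one
    rw [← hmp, h1, trace_sum] at h2
    simp only [trace_kronecker, (hσ _).trace_eq_one, one_mul] at h2
    rw [← Complex.re_sum, h2, Complex.one_re]
  · rw [h1]
    refine Finset.sum_congr rfl fun i _ => ?_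
    rw [← kronecker_smul, ← hKτ]

/-- Preprocessing by an entanglement-breaking channel turns every ensemble into a separable one. -/
theorem SepSufficient.sufficient [Nonempty A] {Φ : Op A →ₗ[ℂ] Op B} {Φ' : Op A →ₗ[ℂ] Op B'}
    {Υ : Op C →ₗ[ℂ] Op C} (hΥ : IsChannel Υ) (hΥ' : IsMeasureAndPrepare Υ)
    (h : SepSufficient U (tensorMap (LinearMap.id : Op C →ₗ[ℂ] Op C) Φ)
      (tensorMap (LinearMap.id : Op C →ₗ[ℂ] Op C) Φ')) :
    Sufficient U (tensorMap Υ Φ) (tensorMap Υ Φ') := by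
  intro E
  have h1 : tensorMap Υ Φ = tensorMap LinearMap.id Φ ∘ₗ tensorMap Υ LinearMap.id := by
    rw [← tensorMap_comp, LinearMap.id_comp, LinearMap.comp_id]
  have h2 : tensorMap Υ Φ' = tensorMap LinearMap.id Φ' ∘ₗ tensorMap Υ LinearMap.id := by
    rw [← tensorMap_comp, LinearMap.id_comp, LinearMap.comp_id]
  rw [h1, h2]
  exact h ⟨E.p, fun x => tensorMap Υ LinearMap.id (E.ω x), E.p_nonneg, E.p_sum,
    fun x => (hΥ.tensorMap isChannel_id).map_isState (E.isState x)⟩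
    fun x => hΥ'.isSeparable (E.isState x)

/-! ### The equivalence for complete channels -/

/-- The equivalence for an arbitrary complete channel on the auxiliary system. -/
theorem IsCompleteChannel.tfae [Nonempty A] [Nonempty C]
    (hC : Fintype.card C = Fintype.card B') {Φ : Op A →ₗ[ℂ] Op B} (hΦ : IsChannel Φ)
    {Φ' : Op A →ₗ[ℂ] Op B'} (hΦ' : IsChannel Φ') {Υ : Op C →ₗ[ℂ] Op C}
    (hΥ : IsCompleteChannel Υ) :
    List.TFAE [
      ∀ (U : Type u) [Fintype U], Sufficient U (tensorMap Υ Φ) (tensorMap Υ Φ'),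
      ∃ (U : Type u) (_ : Fintype U), Fintype.card U = Fintype.card B' ^ 2 ∧
        Sufficient U (tensorMap Υ Φ) (tensorMap Υ Φ'),
      ∃ Ψ : Op B →ₗ[ℂ] Op B', IsChannel Ψ ∧ Φ' = Ψ ∘ₗ Φ] := by
  tfae_have 1 → 2 := fun h => ⟨ULift (Fin (Fintype.card B' ^ 2)), inferInstance, by simp, h _⟩
  tfae_have 2 → 3 := fun ⟨_, _, hU, h⟩ => h.exists_isChannel_comp hC hU hΦ hΦ' hΥ
  tfae_have 3 → 1 := fun ⟨_, hΨ, h⟩ _ _ => Sufficient.of_comp hΨ h Υ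
  tfae_finish

end

end Quantum

theorem mainTheorem5 {A B B' B'' : Type*}
    [Fintype A] [DecidableEq A] [Nonempty A] [Fintype B] [DecidableEq B]
    [Fintype B'] [DecidableEq B'] [Fintype B''] [DecidableEq B'']
    (hB'' : Fintype.card B'' = Fintype.card B')
    (Φ : Quantum.Op A →ₗ[ℂ] Quantum.Op B) (hΦ : Quantum.IsChannel Φ)
    (Φ' : Quantum.Op A →ₗ[ℂ] Quantum.Op B') (hΦ' : Quantum.IsChannel Φ') :
    -- the equivalence, with the identity channel on the auxiliary system
    List.TFAE [
      ∀ (U : Type u) [Fintype U], Quantum.Sufficient U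
        (Quantum.tensorMap (LinearMap.id : Quantum.Op B'' →ₗ[ℂ] Quantum.Op B'') Φ)
        (Quantum.tensorMap (LinearMap.id : Quantum.Op B'' →ₗ[ℂ] Quantum.Op B'') Φ'),
      ∃ (U : Type u) (_ : Fintype U), Fintype.card U = Fintype.card B' ^ 2 ∧ Quantum.Sufficient U
        (Quantum.tensorMap (LinearMap.id : Quantum.Op B'' →ₗ[ℂ] Quantum.Op B'') Φ)
        (Quantum.tensorMap (LinearMap.id : Quantum.Op B'' →ₗ[ℂ] Quantum.Op B'') Φ'),
      ∃ Ψ : Quantum.Op B →ₗ[ℂ] Quantum.Op B', Quantum.IsChannel Ψ ∧ Φ' = Ψ ∘ₗ Φ] ∧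
    -- the equivalence, with an arbitrary complete channel in place of the identity
    (∀ Υ : Quantum.Op B'' →ₗ[ℂ] Quantum.Op B'', Quantum.IsCompleteChannel Υ →
      List.TFAE [
        ∀ (U : Type u) [Fintype U], Quantum.Sufficient U
          (Quantum.tensorMap Υ Φ) (Quantum.tensorMap Υ Φ'),
        ∃ (U : Type u) (_ : Fintype U), Fintype.card U = Fintype.card B' ^ 2 ∧
          Quantum.Sufficient U (Quantum.tensorMap Υ Φ) (Quantum.tensorMap Υ Φ'),
        ∃ Ψ : Quantum.Op B →ₗ[ℂ] Quantum.Op B', Quantum.IsChannel Ψ ∧ Φ' = Ψ ∘ₗ Φ]) ∧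
    -- a complete channel can be of measure-and-prepare form
    (∃ Υ : Quantum.Op B'' →ₗ[ℂ] Quantum.Op B'',
      Quantum.IsCompleteChannel Υ ∧ Quantum.IsMeasureAndPrepare Υ) ∧
    -- the equivalence, with separable probe states only
    List.TFAE [
      ∀ (U : Type u) [Fintype U], Quantum.SepSufficient U
        (Quantum.tensorMap (LinearMap.id : Quantum.Op B'' →ₗ[ℂ] Quantum.Op B'') Φ)
        (Quantum.tensorMap (LinearMap.id : Quantum.Op B'' →ₗ[ℂ] Quantum.Op B'') Φ'),
      ∃ (U : Type u) (_ : Fintype U), Fintype.card U = Fintype.card B' ^ 2 ∧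
        Quantum.SepSufficient U
          (Quantum.tensorMap (LinearMap.id : Quantum.Op B'' →ₗ[ℂ] Quantum.Op B'') Φ)
          (Quantum.tensorMap (LinearMap.id : Quantum.Op B'' →ₗ[ℂ] Quantum.Op B'') Φ'),
      ∃ Ψ : Quantum.Op B →ₗ[ℂ] Quantum.Op B', Quantum.IsChannel Ψ ∧ Φ' = Ψ ∘ₗ Φ] := by
  -- trace preservation rules out an empty output space, so the auxiliary system is nonzero too
  have hB' : Nonempty B' := by
    by_contra h
    rw [not_nonempty_iff] at h
    have h := hΦ'.tracePreserving 1
    rw [Matrix.trace_one, Matrix.trace, Finset.univ_eq_empty, Finset.sum_empty] at h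
    exact Fintype.card_ne_zero (α := A) (by exact_mod_cast h.symm)
  have : Nonempty B'' := Fintype.card_pos_iff.1 (by rw [hB'']; exact Fintype.card_pos)
  obtain ⟨Υ₀, hΥ₀, hΥ₀'⟩ := Quantum.exists_isCompleteChannel_isMeasureAndPrepare (A := B'')
  refine ⟨Quantum.isCompleteChannel_id.tfae hB'' hΦ hΦ', fun Υ hΥ => hΥ.tfae hB'' hΦ hΦ',
    ⟨Υ₀, hΥ₀, hΥ₀'⟩, ?_⟩
  tfae_have 1 → 2 := fun h => ⟨ULift (Fin (Fintype.card B' ^ 2)), inferInstance, by simp, h _⟩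
  tfae_have 2 → 3 := fun ⟨_, _, hU, h⟩ =>
    (h.sufficient hΥ₀.toIsChannel hΥ₀').exists_isChannel_comp hB'' hU hΦ hΦ' hΥ₀
  tfae_have 3 → 1 := fun ⟨_, hΨ, h⟩ _ _ E _ => Quantum.Sufficient.of_comp hΨ h _ E
  tfae_finish
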